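/- **Propagation of chaos.** *Parameters.* Let $M\ge 1$ be an integer, $0<\beta<1$, and let $\Phi,\Psi$ be probability laws on $\mathbb R^+=[0,\infty)$ with bounded Lebesgue densities, $\Phi$ being supported in a bounded interval $[0,\bar A]$. Let $C:\mathbb R^+\to\mathbb R^+$ be continuous, increasing and strictly convex with $C(q)=O(q^m)$ for some integer $m$. *The system with $N$ cells.* There are $NM$ agents; $Q^N_i(t)\in\mathbb R^+$ is the queue length of agent $i$ at time $t\in\{0,1,2,\dots\}$. At each time the agents are assigned to the $N$ cells by a uniformly random permutation, exactly $M$ per cell. In each cell the agent with the highest bid wins (ties are broken uniformly at random). With probability $1-\beta$ agent $i$ regenerates and $Q_i^N(t+1)=R_{i,t}$ with $R_{i,t}\sim\Psi$; otherwise $Q_i^N(t+1)=Q_i^N(t)-\min\{1,Q_i^N(t)\}\mathbf 1(i\text{ wins at }t)+A_{i,t}$ with $A_{i,t}\sim\Phi$. All permutations, regeneration events, arrivals and regeneration values are independent of each other and of the initial queue lengths. *Mean field equilibrium.* Let $\rho$ be the c.d.f. of a law on $\mathbb R^+$ without atoms (not even at $0$) with $\int_0^\infty(1-\rho(x))\,dx<E$,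 where $E<\infty$. Put $p_\rho(x)=\rho(x)^{M-1}$ and $r_\rho(x)=\mathbb E[\bar X\mathbf 1\{\bar X\le x\}]$, where $\bar X$ is the maximum of $M-1$ independent bids with c.d.f. $\rho$ (and $\bar X=0$ if $M=1$). A Markov deterministic policy $\pi=(\pi_t)_{t\ge 0}$ is a sequence of measurable maps $\pi_t:\mathbb R^+\to\mathbb R^+$ from queue lengths to bids. Its cost from $q$ is $\mathbb E\big[\sum_{t\ge 0}\beta^t\,(C(Q_t)+r_\rho(X_t))\big]$ with $Q_0=q$, $X_t=\pi_t(Q_t)$, where $Q_t$ evolves without regeneration: given $Q_t$, $Q_{t+1}=(Q_t-1)^++A_t$ with probability $p_\rho(X_t)$ and $Q_{t+1}=Q_t+A_t$ otherwise, $A_t\sim\Phi$ being independent of the rest. (The factor $\beta^t$ accounts for regeneration.) The pair $(\rho,\theta_\rho)$, with $\theta_\rho:\mathbb R^+\to\mathbb R^+$ measurable, is a mean field equilibrium if the stationary policy $\theta_\rho$ attains, for every $q$, the infimum of the cost over all Markov deterministic policies, and $\rho(x)=\Pi_\rho(\theta_\rho^{-1}([0,x]))$ for all $x\ge 0$. Here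 $\Pi_\rho$ is the stationary law of the transition kernel $$q\mapsto \beta\,p_\rho(\theta_\rho(q))\,\mathbb P((q-1)^++A\in\cdot)+\beta\,(1-p_\rho(\theta_\rho(q)))\,\mathbb P(q+A\in\cdot)+(1-\beta)\Psi,\qquad A\sim\Phi .$$ *Claim.* Let $(\rho,\theta_\rho)$ be a mean field equilibrium. For every $N$ let the initial queue lengths $Q^N_1(0),\dots,Q^N_{NM}(0)$ be i.i.d. with law $\Pi_\rho$, and let every agent always bid $\theta_\rho(Q_i^N(t))$. Then for all $k$, all fixed distinct indices $i_1,\dots,i_k$ and every time $T\in\{0,1,2,\dots\}$, $$\mathcal L\big(Q^N_{i_1}(T),\dots,Q^N_{i_k}(T)\big)\Rightarrow \Pi_\rho^{\otimes k}\qquad (N\to\infty),$$ where $\Rightarrow$ denotes weak convergence. -/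

import Mathlib

open MeasureTheory ProbabilityTheory Filter Topology
open scoped NNReal ENNReal

namespace CellAuction

/-! ### Model data -/

/-- A law on `[0, ∞)` with a bounded density with respect to Lebesgue measure on the line. -/
def HasBoundedDensity (μ : Measure ℝ≥0) : Prop :=
  ∃ φ : ℝ → ℝ≥0, Measurable φ ∧ (∃ c : ℝ≥0, ∀ x, φ x ≤ c) ∧
    μ.map (fun q : ℝ≥0 => (q : ℝ)) = volume.withDensity (fun x => (φ x : ℝ≥0∞))

/-- The parameters of the scheduling game, with the standing assumptions on them:
`M` agents per cell, continuation probability `β`, arrival law `Φ`, regeneration law `Ψ` and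
holding cost `C`. -/
structure Model where
  M : ℕ
  one_le_M : 1 ≤ M
  β : ℝ≥0
  β_pos : 0 < β
  β_lt_one : β < 1
  Φ : ProbabilityMeasure ℝ≥0
  arrival_bounded : ∃ a : ℝ≥0, ∀ᵐ x ∂(Φ : Measure ℝ≥0), x ≤ a
  arrival_density : HasBoundedDensity (Φ : Measure ℝ≥0)
  Ψ : ProbabilityMeasure ℝ≥0
  regeneration_density : HasBoundedDensity (Ψ : Measure ℝ≥0)
  C : ℝ≥0 → ℝ≥0
  cost_continuous : Continuous C
  cost_monotone : Monotone C
  cost_strictConvex : StrictConvexOn ℝ≥0 Set.univ C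
  cost_polynomial : ∃ m : ℕ,
    (fun q : ℝ≥0 => (C q : ℝ)) =O[atTop] (fun q : ℝ≥0 => (q : ℝ) ^ m)

/-- A decision rule: a measurable map from workloads to bids. -/
abbrev Rule : Type := {θ : ℝ≥0 → ℝ≥0 // Measurable θ}

/-- The bid laws over which agents may hold beliefs: laws on `[0, ∞)` with a continuous
cumulative distribution function (no atoms, not even at `0`) and `∫ (1 - ρ(x)) dx < E`. -/
def IsBidLaw (E : ℝ≥0) (ρ : ProbabilityMeasure ℝ≥0) : Prop :=
  (∀ x : ℝ≥0, (ρ : Measure ℝ≥0) {x} = 0) ∧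
    ∫⁻ x in Set.Ici (0 : ℝ), (ρ : Measure ℝ≥0) {y : ℝ≥0 | x < (y : ℝ)} < (E : ℝ≥0∞)

/-- The remaining workload when the server grants at most one unit to a winner. -/
noncomputable def afterService (win : Prop) [Decidable win] (q : ℝ≥0) : ℝ≥0 :=
  q - if win then min 1 q else 0

namespace Model

/-! ### The mean field decision problem -/

section MeanField

variable (S : Model) (ρ : ProbabilityMeasure ℝ≥0)

/-- The law of the highest of `M - 1` independent bids drawn from `ρ`
(the maximum of no bids is `0`). -/
noncomputable def maxBidLaw : Measure ℝ≥0 :=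
  (Measure.pi (fun _ : Fin (S.M - 1) => (ρ : Measure ℝ≥0))).map (fun b => Finset.univ.sup b)

/-- The probability that a bid of `x` wins: no opposing bid exceeds `x`. -/
noncomputable def winProb (x : ℝ≥0) : ℝ≥0∞ := (ρ : Measure ℝ≥0) (Set.Iic x) ^ (S.M - 1)

theorem maxBidLaw_Iic (x : ℝ≥0) : S.maxBidLaw ρ (Set.Iic x) = S.winProb ρ x := by
  have hm : Measurable (fun b : Fin (S.M - 1) → ℝ≥0 => Finset.univ.sup b) := by
    have : (fun b : Fin (S.M - 1) → ℝ≥0 => Finset.univ.sup b)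
        = Finset.univ.sup fun i (b : Fin (S.M - 1) → ℝ≥0) => b i := by
      ext b; simp [Finset.sup_apply]
    rw [this]
    exact Finset.sup_induction measurable_const (fun _ h _ h' => h.sup h')
      (fun i _ => measurable_pi_apply i)
  rw [maxBidLaw, Measure.map_apply hm measurableSet_Iic]
  have : (fun b : Fin (S.M - 1) → ℝ≥0 => Finset.univ.sup b) ⁻¹' Set.Iic x
      = Set.univ.pi fun _ => Set.Iic x := by
    ext b; simp [Pi.le_def]
  rw [this, Measure.pi_pi]
  simp [winProb]

/-- The expected payment `E[X̄ 1{X̄ ≤ x}]` of an agent that bids `x`. -/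
noncomputable def payment (x : ℝ≥0) : ℝ≥0∞ := ∫⁻ y in Set.Iic x, (y : ℝ≥0∞) ∂(S.maxBidLaw ρ)

theorem measurable_winProb : Measurable (S.winProb ρ) := by
  have : Monotone (fun x : ℝ≥0 => (ρ : Measure ℝ≥0) (Set.Iic x)) :=
    fun _ _ h => measure_mono (Set.Iic_subset_Iic.2 h)
  exact this.measurable.pow_const _

theorem winProb_le_one (x : ℝ≥0) : S.winProb ρ x ≤ 1 :=
  pow_le_one₀ zero_le prob_le_one

/-- The law of `q + A`, with `A` an arrival. -/
noncomputable def arrive : Kernel ℝ≥0 ℝ≥0 where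
  toFun q := (S.Φ : Measure ℝ≥0).map (fun a => q + a)
  measurable' := by
    refine Measure.measurable_of_measurable_coe _ fun B hB => ?_
    have h : ∀ q : ℝ≥0, (S.Φ : Measure ℝ≥0).map (fun a => q + a) B
        = (S.Φ : Measure ℝ≥0) (Prod.mk q ⁻¹' ((fun p : ℝ≥0 × ℝ≥0 => p.1 + p.2) ⁻¹' B)) :=
      fun q => Measure.map_apply (measurable_const_add q) hB
    simp only [h]
    exact measurable_measure_prodMk_left (measurable_add hB)

/-- The transition of the workload of an agent that bids by the rule `θ`, whose opponents' bids
are independent with law `ρ`, and that does not regenerate. -/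
noncomputable def serveKernel (θ : Rule) : Kernel ℝ≥0 ℝ≥0 where
  toFun q := S.winProb ρ (θ.1 q) • S.arrive (q - 1) + (1 - S.winProb ρ (θ.1 q)) • S.arrive q
  measurable' := by
    have hw : Measurable fun q => S.winProb ρ (θ.1 q) := (S.measurable_winProb ρ).comp θ.2
    refine Measure.measurable_of_measurable_coe _ fun B hB => ?_
    simp only [Measure.add_apply, Measure.smul_apply, smul_eq_mul]
    exact (hw.mul ((S.arrive.measurable_coe hB).comp (measurable_id.sub_const 1))).add
      ((measurable_const.sub hw).mul (S.arrive.measurable_coe hB))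

/-- The mean field transition kernel: with probability `1 - β` the agent regenerates from `Ψ`. -/
noncomputable def meanFieldKernel (θ : Rule) : Kernel ℝ≥0 ℝ≥0 where
  toFun q := S.β • S.serveKernel ρ θ q + (1 - S.β) • (S.Ψ : Measure ℝ≥0)
  measurable' := by
    refine Measure.measurable_of_measurable_coe _ fun B hB => ?_
    simp only [Measure.add_apply, Measure.smul_apply]
    exact (((S.serveKernel ρ θ).measurable_coe hB).const_smul S.β).add measurable_const

/-- The law at time `t` of a workload that starts from `q`, does not regenerate, and is driven
by the Markov deterministic policy `π` (a decision rule for every time). -/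
noncomputable def stateLaw (π : ℕ → Rule) (q : ℝ≥0) : ℕ → Measure ℝ≥0
  | 0 => Measure.dirac q
  | t + 1 => (stateLaw π q t).bind (S.serveKernel ρ (π t))

/-- The expected total cost `E[∑ βᵗ (C(Q_t) + r_ρ(X_t))]` of the policy `π` from workload `q`.
The factor `βᵗ` is the probability that the agent has not regenerated before time `t`. -/
noncomputable def policyCost (π : ℕ → Rule) (q : ℝ≥0) : ℝ≥0∞ :=
  ∑' t : ℕ, (S.β : ℝ≥0∞) ^ t *
    ∫⁻ x, ((S.C x : ℝ≥0∞) + S.payment ρ ((π t).1 x)) ∂(S.stateLaw ρ π q t)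

/-- The optimal value function. -/
noncomputable def optimalValue (q : ℝ≥0) : ℝ≥0∞ := ⨅ π : ℕ → Rule, S.policyCost ρ π q

/-- The stationary policy `θ` is optimal against the bid law `ρ`. -/
def IsOptimal (θ : Rule) : Prop :=
  ∀ q : ℝ≥0, S.policyCost ρ (fun _ => θ) q = S.optimalValue ρ q

/-- `(ρ, θ)` is a mean field equilibrium with stationary workload law `Piρ`: the policy `θ` is
optimal against `ρ`, the law `Piρ` is stationary for the resulting chain, and the bid law induced by
`Piρ` and `θ` is `ρ`. -/
structure IsMeanFieldEquilibrium (E : ℝ≥0) (θ : Rule) (Piρ : ProbabilityMeasure ℝ≥0) : Prop where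
  isBidLaw : IsBidLaw E ρ
  optimal : S.IsOptimal ρ θ
  stationary : (S.meanFieldKernel ρ θ).Invariant (Piρ : Measure ℝ≥0)
  consistent : ∀ x : ℝ≥0,
    (ρ : Measure ℝ≥0) (Set.Iic x) = (Piρ : Measure ℝ≥0) (θ.1 ⁻¹' Set.Icc 0 x)

end MeanField

/-! ### The system with `N` cells and `N * M` agents -/

section Finite

variable (S : Model) (N : ℕ)

/-- An assignment of the agents to the seats; seat `(c, s)` is the `s`-th place of cell `c`. -/
abbrev Assignment : Type := Fin (N * S.M) ≃ Fin N × Fin S.M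

instance : MeasurableSpace (S.Assignment N) := ⊤

instance : DiscreteMeasurableSpace (S.Assignment N) := ⟨fun _ => trivial⟩

instance : Nonempty (S.Assignment N) := ⟨finProdFinEquiv.symm⟩

/-- The agents' private randomness at one time: whether the agent regenerates, its arrival, and
its workload in case of regeneration. -/
abbrev AgentShock : Type := Bool × ℝ≥0 × ℝ≥0

/-- Agent `i` wins the auction of its cell: its bid is highest, and among the highest bidders of
its cell it has the first seat (the seats being random, ties are broken uniformly at random). -/
def Wins (σ : S.Assignment N) (bid : Fin (N * S.M) → ℝ≥0) (i : Fin (N * S.M)) : Prop :=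
  ∀ j, j ≠ i → (σ j).1 = (σ i).1 → bid j < bid i ∨ (bid j = bid i ∧ (σ i).2 < (σ j).2)

open scoped Classical in
/-- One time step of the system in which all agents bid by the rule `θ`. -/
noncomputable def step (θ : Rule)
    (x : (Fin (N * S.M) → ℝ≥0) × S.Assignment N × (Fin (N * S.M) → AgentShock)) :
    Fin (N * S.M) → ℝ≥0 :=
  fun i =>
    if (x.2.2 i).1 = true then (x.2.2 i).2.2
    else afterService (S.Wins N x.2.1 (fun j => θ.1 (x.1 j)) i) (x.1 i) + (x.2.2 i).2.1

theorem measurable_step (θ : Rule) : Measurable (S.step N θ) := by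
  classical
  refine measurable_pi_lambda _ fun i => ?_
  have hq : ∀ j, Measurable fun x : (Fin (N * S.M) → ℝ≥0) × S.Assignment N ×
      (Fin (N * S.M) → AgentShock) => x.1 j := fun j => (measurable_pi_apply j).comp measurable_fst
  have hb : ∀ j, Measurable fun x : (Fin (N * S.M) → ℝ≥0) × S.Assignment N ×
      (Fin (N * S.M) → AgentShock) => θ.1 (x.1 j) := fun j => θ.2.comp (hq j)
  have hs : Measurable fun x : (Fin (N * S.M) → ℝ≥0) × S.Assignment N ×
      (Fin (N * S.M) → AgentShock) => x.2.2 i :=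
    (measurable_pi_apply i).comp (measurable_snd.comp measurable_snd)
  have hσ : ∀ A : Set (S.Assignment N), MeasurableSet {x : (Fin (N * S.M) → ℝ≥0) ×
      S.Assignment N × (Fin (N * S.M) → AgentShock) | x.2.1 ∈ A} := fun A =>
    (measurable_fst.comp measurable_snd) (MeasurableSet.of_discrete (s := A))
  have hW : MeasurableSet {x : (Fin (N * S.M) → ℝ≥0) × S.Assignment N ×
      (Fin (N * S.M) → AgentShock) | S.Wins N x.2.1 (fun j => θ.1 (x.1 j)) i} := by
    simp only [Wins, Set.ofPred_forall]
    refine MeasurableSet.iInter fun j => MeasurableSet.iInter fun _ => ?_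
    have h1 := hσ {σ | (σ j).1 = (σ i).1}
    have h2 := hσ {σ | (σ i).2 < (σ j).2}
    exact h1.imp ((measurableSet_lt (hb j) (hb i)).union
      ((measurableSet_eq_fun (hb j) (hb i)).inter h2))
  refine Measurable.ite ?_ (measurable_snd.comp (measurable_snd.comp hs)) ?_
  · exact (measurable_fst.comp hs) (measurableSet_singleton true)
  · refine Measurable.add ?_ (measurable_fst.comp (measurable_snd.comp hs))
    exact (hq i).sub (Measurable.ite hW (measurable_const.min (hq i)) measurable_const)

/-- The law of an agent's shock: regeneration (probability `1 - β`), arrival (law `Φ`) and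
regenerated workload (law `Ψ`) are independent. -/
noncomputable def agentShockLaw : ProbabilityMeasure AgentShock :=
  ProbabilityMeasure.prod
    ⟨(1 - S.β) • Measure.dirac true + S.β • Measure.dirac false, ⟨by
      rw [Measure.add_apply, Measure.smul_apply, Measure.smul_apply, measure_univ, measure_univ,
        ← add_smul, tsub_add_cancel_of_le S.β_lt_one.le, one_smul]⟩⟩
    (S.Φ.prod S.Ψ)

/-- The assignment of the agents to the seats is uniformly distributed. -/
noncomputable def assignmentLaw : ProbabilityMeasure (S.Assignment N) :=
  ⟨(PMF.uniformOfFintype (S.Assignment N)).toMeasure, inferInstance⟩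

/-- The law at time `t` of the vector of all workloads, when the initial workloads are i.i.d. with
law `init` and all agents bid by the rule `θ`: at every time the assignment and the shocks of the
agents are independent of each other and of the past. -/
noncomputable def queueLaw (θ : Rule) (init : ProbabilityMeasure ℝ≥0) :
    ℕ → ProbabilityMeasure (Fin (N * S.M) → ℝ≥0)
  | 0 => ProbabilityMeasure.pi fun _ => init
  | t + 1 =>
    ((queueLaw θ init t).prod
      ((S.assignmentLaw N).prod (ProbabilityMeasure.pi fun _ => S.agentShockLaw))).map
        (S.measurable_step N θ).aemeasurable

/-- The workloads of the agents with labels `i 0, …, i (k - 1)`; the agents are labelled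
`0, …, N * M - 1`, and a label without an agent gets the value `0`. -/
def select {k : ℕ} (i : Fin k → ℕ) (q : Fin (N * S.M) → ℝ≥0) : Fin k → ℝ≥0 :=
  fun j => if h : i j < N * S.M then q ⟨i j, h⟩ else 0

theorem measurable_select {k : ℕ} (i : Fin k → ℕ) : Measurable (S.select N i) := by
  refine measurable_pi_lambda _ fun j => ?_
  by_cases h : i j < N * S.M
  · simpa [select, h] using measurable_pi_apply _
  · simp [select, h]

/-- The joint law at time `t` of the workloads of the agents with labels `i 0, …, i (k - 1)`. -/
noncomputable def tupleLaw (θ : Rule) (init : ProbabilityMeasure ℝ≥0) {k : ℕ} (i : Fin k → ℕ)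
    (t : ℕ) : ProbabilityMeasure (Fin k → ℝ≥0) :=
  (S.queueLaw N θ init t).map (S.measurable_select N i).aemeasurable

end Finite

end Model

end CellAuction

namespace CellAuction

/-! ### Product measures -/

section ProductMeasures

variable {ι κ X : Type*} [Fintype ι] [Fintype κ] [MeasurableSpace X]

theorem pi_map_comp_injective (μ : Measure X) [IsProbabilityMeasure μ] {i : ι → κ}
    (hi : Function.Injective i) :
    (Measure.pi fun _ : κ => μ).map (fun x => x ∘ i) = Measure.pi fun _ : ι => μ := by
  classical
  have hm : Measurable fun x : κ → X => x ∘ i :=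
    measurable_pi_lambda _ fun c => measurable_pi_apply (i c)
  refine (Measure.pi_eq fun s hs => ?_).symm
  rw [Measure.map_apply hm (.univ_pi hs)]
  have : (fun x : κ → X => x ∘ i) ⁻¹' Set.univ.pi s
      = Set.univ.pi (Function.extend i s fun _ => Set.univ) := by
    ext x
    simp only [Set.mem_preimage, Set.mem_univ_pi, Function.comp_apply]
    refine ⟨fun h b => ?_, fun h c => by simpa [hi.extend_apply] using h (i c)⟩
    by_cases hb : ∃ c, i c = b
    · obtain ⟨c, rfl⟩ := hb
      simpa [hi.extend_apply] using h c
    · simp [Function.extend_apply' _ _ _ hb]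
  rw [this, Measure.pi_pi, ← Finset.prod_subset (Finset.subset_univ (Finset.univ.image i)),
    Finset.prod_image (fun a _ b _ h => hi h)]
  · simp [hi.extend_apply]
  · intro b _ hb
    have hb : ¬ ∃ c, i c = b := by simpa using hb
    simp [Function.extend_apply' _ _ _ hb]

theorem pi_pi_map_uncurry (μ : Measure X) [IsProbabilityMeasure μ] :
    (Measure.pi fun _ : ι => Measure.pi fun _ : κ => μ).map (fun x p => x p.1 p.2)
      = Measure.pi fun _ : ι × κ => μ := by
  have hm : Measurable fun (x : ι → κ → X) (p : ι × κ) => x p.1 p.2 :=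
    measurable_pi_lambda _ fun p => (measurable_pi_apply p.2).comp (measurable_pi_apply p.1)
  refine (Measure.pi_eq fun s hs => ?_).symm
  rw [Measure.map_apply hm (.univ_pi hs)]
  have : (fun (x : ι → κ → X) (p : ι × κ) => x p.1 p.2) ⁻¹' Set.univ.pi s
      = Set.univ.pi fun c => Set.univ.pi fun r => s (c, r) := by
    ext x
    simp [Set.mem_pi]
  rw [this, Measure.pi_pi]
  simp_rw [Measure.pi_pi]
  rw [Fintype.prod_prod_type]

/-- Independent groups of variables, each with an independent noise variable: applying a map to
each group yields independent outputs. -/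
theorem map_groupwise {Y Z : Type*} [MeasurableSpace Y] [MeasurableSpace Z] (μ : Measure X)
    [IsProbabilityMeasure μ] (ν : Measure Y) [IsProbabilityMeasure ν]
    {f : ι → (κ → X) × Y → Z} (hf : ∀ c, Measurable (f c)) :
    ((Measure.pi fun _ : ι × κ => μ).prod (Measure.pi fun _ : ι => ν)).map
        (fun z c => f c (fun r => z.1 (c, r), z.2 c))
      = Measure.pi fun c => ((Measure.pi fun _ : κ => μ).prod ν).map (f c) := by
  have hp : ∀ c, IsProbabilityMeasure (((Measure.pi fun _ : κ => μ).prod ν).map (f c)) :=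
    fun c => Measure.isProbabilityMeasure_map (hf c).aemeasurable
  have hu : Measurable fun (x : ι → κ → X) (p : ι × κ) => x p.1 p.2 :=
    measurable_pi_lambda _ fun p => (measurable_pi_apply p.2).comp (measurable_pi_apply p.1)
  have hg : Measurable fun (z : (ι × κ → X) × (ι → Y)) c => f c (fun r => z.1 (c, r), z.2 c) := by
    refine measurable_pi_lambda _ fun c => (hf c).comp (Measurable.prodMk ?_ ?_)
    · exact measurable_pi_lambda _ fun r => (measurable_pi_apply (c, r)).comp measurable_fst
    · exact (measurable_pi_apply c).comp measurable_snd
  have h1 := (measurePreserving_arrowProdEquivProdArrow (κ → X) Y ι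
    (fun _ => Measure.pi fun _ : κ => μ) (fun _ => ν)).map_eq
  rw [← Measure.pi_map_pi (fun c => (hf c).aemeasurable), ← pi_pi_map_uncurry (ι := ι) (κ := κ) μ]
  conv_lhs => rw [← Measure.map_id (μ := Measure.pi fun _ : ι => ν)]
  rw [Measure.map_prod_map _ _ hu measurable_id, Measure.map_map hg (hu.prodMap measurable_id),
    ← h1, Measure.map_map (hg.comp (hu.prodMap measurable_id)) (MeasurableEquiv.measurable _)]
  rfl

end ProductMeasures

/-! ### One cell with independent workloads -/

/-- The agent in seat `s` wins against the other seats of its cell. -/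
def SeatWins {M : ℕ} (bid : Fin M → ℝ≥0) (s : Fin M) : Prop :=
  ∀ r, r ≠ s → bid r < bid s ∨ (bid r = bid s ∧ s < r)

open scoped Classical in
/-- The next workload of the agent in seat `s` of a cell with workloads `z.1`, when the private
randomness of the agent is `z.2`. -/
noncomputable def cellStep {M : ℕ} (θ : Rule) (s : Fin M) (z : (Fin M → ℝ≥0) × Model.AgentShock) : ℝ≥0 :=
  if z.2.1 = true then z.2.2.2
  else afterService (SeatWins (fun r => θ.1 (z.1 r)) s) (z.1 s) + z.2.2.1

theorem measurableSet_seatWins {M : ℕ} (θ : Rule) (s : Fin M) :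
    MeasurableSet {y : Fin M → ℝ≥0 | SeatWins (fun r => θ.1 (y r)) s} := by
  have hb : ∀ r, Measurable fun y : Fin M → ℝ≥0 => θ.1 (y r) :=
    fun r => θ.2.comp (measurable_pi_apply r)
  simp only [SeatWins, Set.ofPred_forall]
  refine MeasurableSet.iInter fun r => MeasurableSet.iInter fun _ => ?_
  exact (measurableSet_lt (hb r) (hb s)).union
    ((measurableSet_eq_fun (hb r) (hb s)).inter (.const _))

theorem measurable_cellStep {M : ℕ} (θ : Rule) (s : Fin M) : Measurable (cellStep θ s) := by
  have hq : Measurable fun z : (Fin M → ℝ≥0) × Model.AgentShock => z.1 s :=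
    (measurable_pi_apply s).comp measurable_fst
  refine Measurable.ite ((measurable_fst.comp measurable_snd) (measurableSet_singleton true))
    (measurable_snd.comp (measurable_snd.comp measurable_snd)) (Measurable.add ?_ ?_)
  · exact hq.sub (Measurable.ite (measurable_fst (measurableSet_seatWins θ s))
      (measurable_const.min hq) measurable_const)
  · exact measurable_fst.comp (measurable_snd.comp measurable_snd)

open scoped Classical in
theorem afterService_eq (win : Prop) (q : ℝ≥0) :
    afterService win q = if win then q - 1 else q := by
  unfold afterService
  split_ifs
  · rcases le_total 1 q with h | h
    · rw [min_eq_left h]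
    · rw [min_eq_right h, tsub_self, tsub_eq_zero_of_le h]
  · exact tsub_zero q

theorem Model.IsMeanFieldEquilibrium.map_eq {S : Model} {ρ : ProbabilityMeasure ℝ≥0} {E : ℝ≥0} {θ : Rule}
    {Piρ : ProbabilityMeasure ℝ≥0} (h : S.IsMeanFieldEquilibrium ρ E θ Piρ) :
    (Piρ : Measure ℝ≥0).map θ.1 = ρ := by
  have := Measure.isProbabilityMeasure_map (μ := (Piρ : Measure ℝ≥0)) θ.2.aemeasurable
  refine Measure.ext_of_Iic _ _ fun x => ?_
  rw [Measure.map_apply θ.2 measurableSet_Iic, h.consistent x]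
  congr 2
  ext y
  simp

/-- Against opponents whose bids have an atomless law, ties are negligible. -/
theorem pi_opponents_lose {n : ℕ} {μ ρ : Measure ℝ≥0} [IsProbabilityMeasure μ]
    (θ : Rule) (hθ : μ.map θ.1 = ρ) (hρ : ∀ x, ρ {x} = 0) (s : Fin (n + 1)) (q : ℝ≥0) :
    (Measure.pi fun _ : Fin n => μ)
        {y | SeatWins (fun r => θ.1 ((s.insertNth q y : Fin (n + 1) → ℝ≥0) r)) s}
      = ρ (Set.Iic (θ.1 q)) ^ n := by
  classical
  have hset : {y : Fin n → ℝ≥0 |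
        SeatWins (fun r => θ.1 ((s.insertNth q y : Fin (n + 1) → ℝ≥0) r)) s}
      = Set.univ.pi fun r => θ.1 ⁻¹'
          (if s < s.succAbove r then Set.Iic (θ.1 q) else Set.Iio (θ.1 q)) := by
    ext y
    simp only [Set.mem_ofPred_eq, Set.mem_univ_pi, SeatWins]
    rw [Fin.forall_iff_succAbove s]
    simp only [ne_eq, not_true_eq_false, false_implies, true_and, Fin.insertNth_apply_same,
      Fin.insertNth_apply_succAbove, Fin.succAbove_ne, not_false_eq_true, true_implies]
    refine forall_congr' fun r => ?_
    split_ifs with h <;> simp [h, le_iff_lt_or_eq]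
  rw [hset, Measure.pi_pi]
  have : ∀ r : Fin n, μ (θ.1 ⁻¹'
      (if s < s.succAbove r then Set.Iic (θ.1 q) else Set.Iio (θ.1 q))) = ρ (Set.Iic (θ.1 q)) := by
    intro r
    rw [← Measure.map_apply θ.2 (by split_ifs <;> measurability), hθ]
    split_ifs
    · rfl
    · exact measure_congr (Iio_ae_eq_Iic' (hρ _))
  simp [this]

theorem Model.agentShockLaw_cellStep (S : Model) (B : Set ℝ≥0) (hB : MeasurableSet B) (q : ℝ≥0) :
    (S.agentShockLaw : Measure Model.AgentShock)
        {w | (if w.1 = true then w.2.2 else q + w.2.1) ∈ B}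
      = S.β • S.arrive q B + (1 - S.β) • (S.Ψ : Measure ℝ≥0) B := by
  have hE : MeasurableSet {w : Model.AgentShock | (if w.1 = true then w.2.2 else q + w.2.1) ∈ B} := by
    have : Measurable fun w : Model.AgentShock => if w.1 = true then w.2.2 else q + w.2.1 :=
      Measurable.ite (measurable_fst (measurableSet_singleton true))
        (measurable_snd.comp measurable_snd) ((measurable_fst.comp measurable_snd).const_add q)
    exact this hB
  have h1 : ((S.Φ : Measure ℝ≥0).prod (S.Ψ : Measure ℝ≥0)) {w | w.2 ∈ B} = (S.Ψ : Measure ℝ≥0) B := by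
    have : {w : ℝ≥0 × ℝ≥0 | w.2 ∈ B} = Set.univ ×ˢ B := by ext; simp
    rw [this, Measure.prod_prod]; simp
  have h2 : ((S.Φ : Measure ℝ≥0).prod (S.Ψ : Measure ℝ≥0)) {w | q + w.1 ∈ B} = S.arrive q B := by
    have : {w : ℝ≥0 × ℝ≥0 | q + w.1 ∈ B} = {a | q + a ∈ B} ×ˢ Set.univ := by ext; simp
    rw [this, Measure.prod_prod]
    have := Measure.map_apply (μ := (S.Φ : Measure ℝ≥0)) (measurable_const_add q) hB
    simp only [measure_univ, mul_one]
    exact this.symm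
  have hlaw : (S.agentShockLaw : Measure Model.AgentShock)
      = ((1 - S.β) • Measure.dirac true + S.β • Measure.dirac false).prod
          ((S.Φ : Measure ℝ≥0).prod (S.Ψ : Measure ℝ≥0)) := rfl
  rw [hlaw, Measure.prod_apply hE, lintegral_add_measure, lintegral_smul_measure, lintegral_smul_measure, lintegral_dirac,
    lintegral_dirac]
  simp only [Set.preimage_ofPred_eq, if_true, Bool.false_eq_true, if_false]
  rw [h1, h2, add_comm]

/-- An agent in a cell with independent workloads of the equilibrium law keeps that law. -/
theorem map_cellStep {S : Model} {ρ : ProbabilityMeasure ℝ≥0} {E : ℝ≥0} {θ : Rule}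
    {Piρ : ProbabilityMeasure ℝ≥0} (h : S.IsMeanFieldEquilibrium ρ E θ Piρ) (s : Fin S.M) :
    ((Measure.pi fun _ : Fin S.M => (Piρ : Measure ℝ≥0)).prod
      (S.agentShockLaw : Measure Model.AgentShock)).map (cellStep θ s) = Piρ := by
  classical
  obtain ⟨n, hn⟩ : ∃ n, S.M = n + 1 := ⟨S.M - 1, (Nat.sub_add_cancel S.one_le_M).symm⟩
  have hw : ∀ q, S.winProb ρ q = (ρ : Measure ℝ≥0) (Set.Iic q) ^ n := by
    intro q; rw [Model.winProb, hn, Nat.add_sub_cancel]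
  revert s
  rw [hn]
  intro s
  refine Measure.ext fun B hB => ?_
  have hm := measurable_cellStep θ s
  rw [Measure.map_apply hm hB, Measure.prod_apply (hm hB)]
  have hsec : ∀ y : Fin (n + 1) → ℝ≥0,
      (S.agentShockLaw : Measure Model.AgentShock) (Prod.mk y ⁻¹' (cellStep θ s ⁻¹' B))
        = S.β • S.arrive (if SeatWins (fun r => θ.1 (y r)) s then y s - 1 else y s) B
          + (1 - S.β) • (S.Ψ : Measure ℝ≥0) B := by
    intro y
    rw [← S.agentShockLaw_cellStep B hB]
    congr 1
    ext w
    change cellStep θ s (y, w) ∈ B ↔ _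
    simp only [cellStep, afterService_eq, Set.mem_ofPred_eq]
  have hmeas : Measurable fun y : Fin (n + 1) → ℝ≥0 =>
      (S.agentShockLaw : Measure Model.AgentShock) (Prod.mk y ⁻¹' (cellStep θ s ⁻¹' B)) :=
    measurable_measure_prodMk_left (hm hB)
  have hp := (measurePreserving_piFinSuccAbove
    (fun _ : Fin (n + 1) => (Piρ : Measure ℝ≥0)) s).symm
  rw [← hp.map_eq, lintegral_map hmeas (MeasurableEquiv.measurable _)]
  refine (lintegral_prod _ (hmeas.comp
    (MeasurableEquiv.piFinSuccAbove (fun _ => ℝ≥0) s).symm.measurable).aemeasurable).trans ?_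
  conv_rhs => rw [← h.stationary, Measure.bind_apply hB (Kernel.aemeasurable _)]
  refine lintegral_congr fun q => ?_
  have hval : ∀ y : Fin n → ℝ≥0,
      (MeasurableEquiv.piFinSuccAbove (fun _ : Fin (n + 1) => ℝ≥0) s).symm (q, y)
        = s.insertNth q y := fun y => rfl
  simp only [Function.comp_apply, hval, hsec, Fin.insertNth_apply_same]
  set W := {y : Fin n → ℝ≥0 |
    SeatWins (fun r => θ.1 ((s.insertNth q y : Fin (n + 1) → ℝ≥0) r)) s} with hW
  have hWm : MeasurableSet W :=
    (measurable_const.prodMk measurable_id : Measurable fun y : Fin n → ℝ≥0 => (q, y)) <|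
      (MeasurableEquiv.piFinSuccAbove (fun _ : Fin (n + 1) => ℝ≥0) s).symm.measurable
        (measurableSet_seatWins θ s)
  have hWp : (Measure.pi fun _ : Fin n => (Piρ : Measure ℝ≥0)) W = S.winProb ρ (θ.1 q) := by
    rw [hw]
    exact pi_opponents_lose θ h.map_eq h.isBidLaw.1 s q
  have hite : ∀ y : Fin n → ℝ≥0,
      S.arrive (if SeatWins (fun r => θ.1 ((s.insertNth q y : Fin (n + 1) → ℝ≥0) r)) s
        then q - 1 else q) B
      = W.indicator (fun _ => S.arrive (q - 1) B) y + Wᶜ.indicator (fun _ => S.arrive q B) y := by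
    intro y
    by_cases hy : y ∈ W
    · have hy' := hy
      rw [hW, Set.mem_ofPred_eq] at hy'
      simp [hy, hy']
    · have hy' := hy
      rw [hW, Set.mem_ofPred_eq] at hy'
      simp [hy, hy']
  simp only [hite]
  have hind : Measurable fun y : Fin n → ℝ≥0 =>
      W.indicator (fun _ => S.arrive (q - 1) B) y + Wᶜ.indicator (fun _ => S.arrive q B) y :=
    (measurable_const.indicator hWm).add (measurable_const.indicator hWm.compl)
  rw [lintegral_add_right _ measurable_const, lintegral_const, measure_univ, mul_one]
  simp only [ENNReal.smul_def, smul_eq_mul]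
  rw [lintegral_const_mul _ hind, lintegral_add_left (measurable_const.indicator hWm),
    lintegral_indicator_const hWm, lintegral_indicator_const hWm.compl, prob_compl_eq_one_sub hWm,
    hWp]
  simp only [Model.meanFieldKernel, Model.serveKernel, Kernel.coe_mk, Measure.add_apply,
    Measure.smul_apply, ENNReal.smul_def, smul_eq_mul]
  ring

namespace Model

variable (S : Model) (N : ℕ)

/-! ### Two agents rarely share a cell -/

open scoped Classical in
theorem card_cellmates (σ : S.Assignment N) (a : Fin (N * S.M)) :
    (Finset.univ.filter fun b => (σ b).1 = (σ a).1).card = S.M := by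
  have : (Finset.univ.filter fun b => (σ b).1 = (σ a).1)
      = (({(σ a).1} : Finset (Fin N)) ×ˢ (Finset.univ : Finset (Fin S.M))).map
          σ.symm.toEmbedding := by
    ext b
    simp [Finset.mem_map_equiv, Prod.ext_iff, eq_comm]
  rw [this, Finset.card_map, Finset.card_product]
  simp

open scoped Classical in
theorem card_sameCell_eq {a b b' : Fin (N * S.M)} (hb : b ≠ a) (hb' : b' ≠ a) :
    (Finset.univ.filter fun σ : S.Assignment N => (σ b).1 = (σ a).1).card
      = (Finset.univ.filter fun σ : S.Assignment N => (σ b').1 = (σ a).1).card := by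
  refine Finset.card_equiv (Equiv.equivCongr (Equiv.swap b b') (Equiv.refl _)) fun σ => ?_
  simp [Equiv.equivCongr, Equiv.swap_apply_of_ne_of_ne hb.symm hb'.symm]

open scoped Classical in
theorem card_sameCell_le {a b : Fin (N * S.M)} (hab : b ≠ a) :
    N * (Finset.univ.filter fun σ : S.Assignment N => (σ b).1 = (σ a).1).card
      ≤ Fintype.card (S.Assignment N) := by
  set c := (Finset.univ.filter fun σ : S.Assignment N => (σ b).1 = (σ a).1).card with hc
  set A := Fintype.card (S.Assignment N) with hA
  have hsum : ∑ b' : Fin (N * S.M),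
      (Finset.univ.filter fun σ : S.Assignment N => (σ b').1 = (σ a).1).card = A * S.M := by
    have := Finset.sum_card_bipartiteAbove_eq_sum_card_bipartiteBelow
      (s := (Finset.univ : Finset (Fin (N * S.M)))) (t := (Finset.univ : Finset (S.Assignment N)))
      (fun b' σ => (σ b').1 = (σ a).1)
    simp only [Finset.bipartiteAbove, Finset.bipartiteBelow, card_cellmates] at this
    rw [this]
    simp [hA]
  rw [← Finset.add_sum_erase _ _ (Finset.mem_univ a), Finset.sum_congr rfl
    (fun b' hb' => card_sameCell_eq S N (Finset.ne_of_mem_erase hb') hab)] at hsum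
  simp only [Finset.sum_const, smul_eq_mul, Finset.card_erase_of_mem (Finset.mem_univ a),
    Finset.filter_true, Finset.card_univ, Fintype.card_fin] at hsum
  rw [← hc, ← hA] at hsum
  have hn : 2 ≤ N * S.M := by
    have := Fintype.one_lt_card_iff.2 ⟨b, a, hab⟩
    simpa [Nat.succ_le_iff] using this
  obtain ⟨n, hn'⟩ : ∃ n, N * S.M = n + 1 := ⟨N * S.M - 1, by omega⟩
  rw [hn', Nat.add_sub_cancel] at hsum
  have hN : 1 ≤ N := by
    rcases Nat.eq_zero_or_pos N with h | h
    · simp [h] at hn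
    · exact h
  refine Nat.le_of_mul_le_mul_left (?_ : n * (N * c) ≤ n * A) (by omega)
  nlinarith [Nat.mul_le_mul_left A hN, congrArg (N * ·) hsum, congrArg (A * ·) hn']

theorem assignmentLaw_sameCell_le {a b : Fin (N * S.M)} (hab : b ≠ a) :
    (S.assignmentLaw N : Measure (S.Assignment N)) {σ | (σ b).1 = (σ a).1} ≤ (N : ℝ≥0∞)⁻¹ := by
  classical
  have hN : N ≠ 0 := by
    rintro rfl
    exact (Fin.cast (Nat.zero_mul _) a).elim0
  simp only [assignmentLaw, ProbabilityMeasure.coe_mk]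
  rw [PMF.toMeasure_uniformOfFintype_apply _ (MeasurableSet.of_discrete)]
  have hc := S.card_sameCell_le N hab
  rw [← Fintype.card_subtype] at hc
  refine ENNReal.div_le_of_le_mul ?_
  rw [mul_comm (N : ℝ≥0∞)⁻¹, ← div_eq_mul_inv, ENNReal.le_div_iff_mul_le (by simp [hN]) (by simp)]
  rw [Nat.mul_comm N (Fintype.card _)] at hc
  exact_mod_cast hc

/-- The probability that two of the agents `j` are in the same cell. -/
theorem assignmentLaw_not_injective_le {ι : Type*} [Fintype ι] {j : ι → Fin (N * S.M)}
    (hj : Function.Injective j) :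
    (S.assignmentLaw N : Measure (S.Assignment N))
        {σ | ¬ Function.Injective fun c => (σ (j c)).1}
      ≤ (Fintype.card (ι × ι) : ℝ≥0∞) * (N : ℝ≥0∞)⁻¹ := by
  classical
  have hsub : {σ : S.Assignment N | ¬ Function.Injective fun c => (σ (j c)).1}
      ⊆ ⋃ p : ι × ι, {σ | p.1 ≠ p.2 ∧ (σ (j p.1)).1 = (σ (j p.2)).1} := by
    intro σ hσ
    simp only [Set.mem_ofPred_eq, Function.Injective, not_forall] at hσ
    obtain ⟨a, b, h, hab⟩ := hσ
    exact Set.mem_iUnion.2 ⟨(a, b), hab, h⟩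
  refine (measure_mono hsub).trans ((measure_iUnion_fintype_le _ _).trans ?_)
  refine (Finset.sum_le_card_nsmul _ _ ((N : ℝ≥0∞)⁻¹) fun p _ => ?_).trans (by simp)
  by_cases hp : p.1 = p.2
  · simp [hp]
  · exact (measure_mono fun σ hσ => hσ.2).trans (S.assignmentLaw_sameCell_le N (hj.ne hp))

/-! ### Propagation of chaos in total variation -/

/-- When the agents `j` are in different cells, their next workloads depend only on the workloads of
the agents in these cells. -/
theorem step_eq_cellStep (θ : Rule) {ι : Type*} (j : ι → Fin (N * S.M))
    (q : Fin (N * S.M) → ℝ≥0) (σ : S.Assignment N) (w : Fin (N * S.M) → AgentShock) (c : ι) :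
    S.step N θ (q, σ, w) (j c)
      = cellStep θ (σ (j c)).2 (fun r => q (σ.symm ((σ (j c)).1, r)), w (j c)) := by
  have hwin : S.Wins N σ (fun i => θ.1 (q i)) (j c)
      ↔ SeatWins (fun r => θ.1 (q (σ.symm ((σ (j c)).1, r)))) (σ (j c)).2 := by
    have hself : σ.symm ((σ (j c)).1, (σ (j c)).2) = j c := by simp
    simp only [Wins, SeatWins, hself]
    constructor
    · intro h r hr
      have hne : σ.symm ((σ (j c)).1, r) ≠ j c := fun h' =>
        hr (by simpa using congrArg (fun i => (σ i).2) h')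
      simpa using h (σ.symm ((σ (j c)).1, r)) hne (by simp)
    · intro h i hi hcell
      have hi' : σ.symm ((σ (j c)).1, (σ i).2) = i := by rw [← hcell]; simp
      have := h (σ i).2 (fun h' => hi (by rw [← hi', h', hself]))
      rwa [hi'] at this
  have hself : σ.symm ((σ (j c)).1, (σ (j c)).2) = j c := by simp
  simp only [step, cellStep, hself, afterService_eq]
  by_cases hW : S.Wins N σ (fun i => θ.1 (q i)) (j c)
  · rw [if_pos hW, if_pos (hwin.1 hW)]
  · rw [if_neg hW, if_neg (mt hwin.2 hW)]

theorem measurable_comp_index {ι κ : Type*} (j : ι → κ) :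
    Measurable fun q : κ → ℝ≥0 => q ∘ j :=
  measurable_pi_lambda _ fun c => measurable_pi_apply (j c)

variable {S N}

theorem shocks_step_le {ρ : ProbabilityMeasure ℝ≥0} {E : ℝ≥0} {θ : Rule}
    {Piρ : ProbabilityMeasure ℝ≥0} (h : S.IsMeanFieldEquilibrium ρ E θ Piρ)
    {ι : Type} [Fintype ι] {ε : ℝ≥0∞} {P : Measure (Fin (N * S.M) → ℝ≥0)}
    (hP : ∀ l : ι × Fin S.M → Fin (N * S.M), Function.Injective l →
      ∀ D : Set (ι × Fin S.M → ℝ≥0), MeasurableSet D →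
        P {q | q ∘ l ∈ D} ≤ Measure.pi (fun _ => (Piρ : Measure ℝ≥0)) D + ε)
    {j : ι → Fin (N * S.M)} (hj : Function.Injective j) {σ : S.Assignment N}
    (hσ : Function.Injective fun c => (σ (j c)).1) {B : Set (ι → ℝ≥0)} (hB : MeasurableSet B) :
    ∫⁻ w, P {q | S.step N θ (q, σ, w) ∘ j ∈ B}
        ∂(Measure.pi fun _ : Fin (N * S.M) => (S.agentShockLaw : Measure AgentShock))
      ≤ Measure.pi (fun _ => (Piρ : Measure ℝ≥0)) B + ε := by
  set l : ι × Fin S.M → Fin (N * S.M) := fun p => σ.symm ((σ (j p.1)).1, p.2) with hl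
  have hlinj : Function.Injective l := by
    rintro ⟨c, r⟩ ⟨c', r'⟩ he
    have := σ.symm.injective he
    simp only [Prod.mk.injEq] at this
    exact Prod.ext (hσ this.1) this.2
  set G : (ι × Fin S.M → ℝ≥0) × (ι → AgentShock) → ι → ℝ≥0 :=
    fun z c => cellStep θ (σ (j c)).2 (fun r => z.1 (c, r), z.2 c) with hG
  have hGm : Measurable G := by
    refine measurable_pi_lambda _ fun c =>
      (measurable_cellStep θ _).comp (Measurable.prodMk ?_ ?_)
    · exact measurable_pi_lambda _ fun r => (measurable_pi_apply (c, r)).comp measurable_fst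
    · exact (measurable_pi_apply c).comp measurable_snd
  have hstep : ∀ q w, S.step N θ (q, σ, w) ∘ j = G (q ∘ l, w ∘ j) :=
    fun q w => funext fun c => S.step_eq_cellStep N θ j q σ w c
  have hbound : ∀ w : Fin (N * S.M) → AgentShock, P {q | S.step N θ (q, σ, w) ∘ j ∈ B}
      ≤ Measure.pi (fun _ => (Piρ : Measure ℝ≥0)) {x | G (x, w ∘ j) ∈ B} + ε := by
    intro w
    simp only [hstep]
    exact hP l hlinj {x | G (x, w ∘ j) ∈ B} ((hGm.comp measurable_prodMk_right) hB)
  refine (lintegral_mono hbound).trans ?_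
  rw [lintegral_add_right _ measurable_const, lintegral_const, measure_univ, mul_one]
  gcongr
  have hsec : Measurable fun v : ι → AgentShock =>
      Measure.pi (fun _ => (Piρ : Measure ℝ≥0)) {x : ι × Fin S.M → ℝ≥0 | G (x, v) ∈ B} :=
    measurable_measure_prodMk_right (hGm hB)
  have hm : Measurable fun w : Fin (N * S.M) → AgentShock => w ∘ j :=
    measurable_pi_lambda _ fun c => measurable_pi_apply (j c)
  have h1 := lintegral_map (μ := Measure.pi fun _ : Fin (N * S.M) =>
    (S.agentShockLaw : Measure AgentShock)) hsec hm
  rw [pi_map_comp_injective _ hj] at h1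
  rw [← h1]
  have h2 := map_groupwise (Piρ : Measure ℝ≥0) (S.agentShockLaw : Measure AgentShock)
    (f := fun c : ι => cellStep θ (σ (j c)).2) (fun c => measurable_cellStep θ _)
  simp only [map_cellStep h] at h2
  rw [← h2, Measure.map_apply hGm hB, Measure.prod_apply_symm (hGm hB)]
  rfl

/-- Uniformly in the choice of finitely many agents, the law of their workloads is eventually within
`ε` of the product law, in total variation. -/
theorem queueLaw_comp_le {ρ : ProbabilityMeasure ℝ≥0} {E : ℝ≥0} {θ : Rule}
    {Piρ : ProbabilityMeasure ℝ≥0} (h : S.IsMeanFieldEquilibrium ρ E θ Piρ) (t : ℕ) :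
    ∀ (ι : Type) [Fintype ι] (ε : ℝ≥0∞), ε ≠ 0 → ∀ᶠ N in atTop,
      ∀ j : ι → Fin (N * S.M), Function.Injective j →
        ∀ B : Set (ι → ℝ≥0), MeasurableSet B →
          (S.queueLaw N θ Piρ t : Measure (Fin (N * S.M) → ℝ≥0)) {q | q ∘ j ∈ B}
            ≤ Measure.pi (fun _ => (Piρ : Measure ℝ≥0)) B + ε := by
  induction t with
  | zero =>
    intro ι _ ε _
    refine Eventually.of_forall fun N j hj B hB => ?_
    have := pi_map_comp_injective (Piρ : Measure ℝ≥0) hj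
    rw [← this, Measure.map_apply (measurable_comp_index j) hB]
    exact le_add_right le_rfl
  | succ t ih =>
    intro ι _ ε hε
    have hε2 : ε / 2 ≠ 0 := by simpa using hε
    have hlim : Tendsto (fun N : ℕ => (Fintype.card (ι × ι) : ℝ≥0∞) * (N : ℝ≥0∞)⁻¹) atTop (𝓝 0) := by
      simpa using ENNReal.Tendsto.const_mul ENNReal.tendsto_inv_nat_nhds_zero
        (Or.inr (ENNReal.natCast_ne_top (Fintype.card (ι × ι))))
    filter_upwards [ih (ι × Fin S.M) (ε / 2) hε2,
      hlim.eventually_le_const (pos_iff_ne_zero.2 hε2)] with N hP hN j hj B hB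
    set P : Measure (Fin (N * S.M) → ℝ≥0) :=
      (S.queueLaw N θ Piρ t : Measure (Fin (N * S.M) → ℝ≥0)) with hPdef
    set L : Measure (Fin (N * S.M) → AgentShock) :=
      Measure.pi fun _ => (S.agentShockLaw : Measure AgentShock) with hL
    set D : Set (S.Assignment N) := {σ | ¬ Function.Injective fun c => (σ (j c)).1} with hD
    have hcomp : MeasurableSet {q : Fin (N * S.M) → ℝ≥0 | q ∘ j ∈ B} := measurable_comp_index j hB
    have hE := S.measurable_step N θ hcomp
    have hlaw : (S.queueLaw N θ Piρ (t + 1) : Measure (Fin (N * S.M) → ℝ≥0)) {q | q ∘ j ∈ B}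
        = ∫⁻ σ, ∫⁻ w, P {q | S.step N θ (q, σ, w) ∘ j ∈ B} ∂L ∂(S.assignmentLaw N : Measure _) := by
      rw [queueLaw, ProbabilityMeasure.toMeasure_map,
        Measure.map_apply (S.measurable_step N θ) hcomp, ProbabilityMeasure.toMeasure_prod,
        ProbabilityMeasure.toMeasure_prod, Measure.prod_apply_symm hE,
        lintegral_prod _ (measurable_measure_prodMk_right hE).aemeasurable]
      rfl
    rw [hlaw]
    calc _ ≤ ∫⁻ σ, ((Measure.pi (fun _ => (Piρ : Measure ℝ≥0)) B + ε / 2)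
            + D.indicator (fun _ => 1) σ) ∂(S.assignmentLaw N : Measure (S.Assignment N)) := by
          refine lintegral_mono fun σ => ?_
          by_cases hσ : σ ∈ D
          · refine le_trans ?_ (le_add_left le_rfl)
            rw [Set.indicator_of_mem hσ]
            exact (lintegral_mono fun w => prob_le_one).trans (by simp)
          · rw [Set.indicator_of_notMem hσ, add_zero]
            exact shocks_step_le h hP hj (not_not.1 hσ) hB
      _ = Measure.pi (fun _ => (Piρ : Measure ℝ≥0)) B + ε / 2
            + (S.assignmentLaw N : Measure (S.Assignment N)) D := by
          rw [lintegral_add_left measurable_const, lintegral_const, measure_univ, mul_one,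
            lintegral_indicator_const MeasurableSet.of_discrete, one_mul]
      _ ≤ Measure.pi (fun _ => (Piρ : Measure ℝ≥0)) B + ε / 2 + ε / 2 := by
          gcongr
          exact (S.assignmentLaw_not_injective_le N hj).trans hN
      _ = _ := by rw [add_assoc, ENNReal.add_halves]

end Model

end CellAuction

theorem mainTheorem9 (S : CellAuction.Model) (E : ℝ≥0) (ρ : ProbabilityMeasure ℝ≥0)
    (θ : CellAuction.Rule) (Piρ : ProbabilityMeasure ℝ≥0)
    (hMFE : S.IsMeanFieldEquilibrium ρ E θ Piρ)
    (k : ℕ) (i : Fin k → ℕ) (hi : Function.Injective i) (T : ℕ) :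
    Tendsto (fun N : ℕ => S.tupleLaw N θ Piρ i T) atTop
      (𝓝 (ProbabilityMeasure.pi fun _ : Fin k => Piρ)) := by
  refine tendsto_of_forall_isOpen_le_liminf' fun G hG => ?_
  refine ENNReal.le_of_forall_pos_le_add fun ε hε _ => ?_
  rw [← tsub_le_iff_right]
  refine le_liminf_of_le (by isBoundedDefault) ?_
  filter_upwards [CellAuction.Model.queueLaw_comp_le hMFE T (Fin k) (ε : ℝ≥0∞) (by simpa using hε.ne'),
    eventually_gt_atTop (Finset.univ.sup i)] with N hN hlt
  have hidx : ∀ c, i c < N * S.M := fun c =>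
    ((Finset.le_sup (Finset.mem_univ c)).trans_lt hlt).trans_le
      (Nat.le_mul_of_pos_right N S.one_le_M)
  have hsel : ∀ q : Fin (N * S.M) → ℝ≥0, S.select N i q = q ∘ fun c => ⟨i c, hidx c⟩ := by
    intro q
    funext c
    simp [CellAuction.Model.select, hidx c]
  have hcompl := hN (fun c => ⟨i c, hidx c⟩) (fun a b hab => hi (by simpa using hab)) Gᶜ
    hG.measurableSet.compl
  have hlaw : (S.tupleLaw N θ Piρ i T : Measure (Fin k → ℝ≥0)) Gᶜ
      ≤ (ProbabilityMeasure.pi fun _ : Fin k => Piρ : Measure (Fin k → ℝ≥0)) Gᶜ + ε := by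
    rw [CellAuction.Model.tupleLaw, ProbabilityMeasure.toMeasure_map,
      Measure.map_apply (S.measurable_select N i) hG.measurableSet.compl]
    simp only [Set.preimage, hsel]
    exact hcompl
  rw [tsub_le_iff_right]
  refine ENNReal.le_of_add_le_add_right (measure_ne_top
    (ProbabilityMeasure.pi fun _ : Fin k => Piρ : Measure (Fin k → ℝ≥0)) Gᶜ) ?_
  rw [measure_add_measure_compl hG.measurableSet, measure_univ, add_assoc, add_comm (ε : ℝ≥0∞)]
  calc (1 : ℝ≥0∞) = (S.tupleLaw N θ Piρ i T : Measure (Fin k → ℝ≥0)) G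
        + (S.tupleLaw N θ Piρ i T : Measure (Fin k → ℝ≥0)) Gᶜ := by
        rw [measure_add_measure_compl hG.measurableSet, measure_univ]
    _ ≤ _ := by gcongr
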